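/- A domain over $\mathbb{R}^n$ is a pair $D=(D_{in},D_{out})$ of Borel probability measures on $\mathbb{R}^n$. A hypothesis is a subset $h\subseteq\mathbb{R}^n$, identified with its indicator function (value $1$ for "in-distribution", $0$ for "out-of-distribution"). For $\alpha\in(0,1)$ its risk is $$R^\alpha_D(h)=(1-\alpha)\,D_{in}(\mathbb{R}^n\setminus h)+\alpha\,D_{out}(h)$$ (outer measures if $h$ is not measurable). A learning algorithm may use internal randomness and has access to an oracle $EX(D_{in})$ that returns independent samples from $D_{in}$; after each sample it decides whether to call the oracle again or to stop and output a hypothesis. For a set $\mathcal{D}$ of domains and a set $\mathcal{H}$ of hypotheses, OOD detection is *uniformly learnable* for $\mathcal{D}$ in $\mathcal{H}$ with OOD probability $\alpha$ if there are a function $N:(0,1/2)^2\to\mathbb{N}$ and a learning algorithm such that for all $\varepsilon,\delta\in(0,1/2)$ and all $D\in\mathcal{D}$ the algorithm, given $\varepsilon$, $\delta$ and access to $EX(D_{in})$, almost surely makes at most $N(\varepsilon,\delta)$ oracle calls and outputs some $h\in\mathcal{H}$, which with probability at least $1-\delta$ (over the samples and the internal randomness) satisfies $$R^\alpha_D(h)\le\inf_{h'\in\mathcal{H}}R^\alpha_D(h')+\varepsilon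 .$$ **Theorem.** Let $n\ge 2$ and let $\mathcal{D}'_c$ be the set of all domains $D=(D_{in},D_{out})$ over $\mathbb{R}^n$ such that - (DSA) $\operatorname{supp}(D_{in})\cap\operatorname{supp}(D_{out})=\emptyset$; - (ContID) $D_{in}$ is absolutely continuous with respect to Lebesgue measure on $\mathbb{R}^n$; - (ConvexID) $\operatorname{supp}(D_{in})$ is a convex subset of $\mathbb{R}^n$. Then for every $\alpha\in(0,1)$, OOD detection is not uniformly learnable for $\mathcal{D}'_c$ in $\mathcal{P}(\mathbb{R}^n)$, the set of all subsets of $\mathbb{R}^n$, with OOD probability $\alpha$. In particular, the combination of DSA, ContID and ConvexID does not always imply the uniform learnability of OOD detection. -/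

import Mathlib

open MeasureTheory

universe u v

noncomputable section

namespace OODDetection

/-- A domain over `X`: a pair of probability distributions on `X`. -/
structure Domain (X : Type*) [MeasurableSpace X] where
  /-- the in-distribution (ID) distribution -/
  inDist : ProbabilityMeasure X
  /-- the out-of-distribution (OOD) distribution -/
  outDist : ProbabilityMeasure X

section Risk

variable {X : Type*} [MeasurableSpace X]

/-- ID risk of the hypothesis `h` (a subset of `X`, identified with its indicator function):
the probability that a point drawn from the ID distribution is not labelled `1`.
For a non-measurable `h` this is the outer measure of the error set. -/
def inRisk (D : Domain X) (h : Set X) : ℝ := (D.inDist : Measure X).real hᶜ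

/-- OOD risk of the hypothesis `h`: the probability that a point drawn from the OOD distribution
is not labelled `0`. -/
def outRisk (D : Domain X) (h : Set X) : ℝ := (D.outDist : Measure X).real h

/-- The 0-1 risk of `h` when a test point is OOD with probability `α`. -/
def risk (α : ℝ) (D : Domain X) (h : Set X) : ℝ := (1 - α) * inRisk D h + α * outRisk D h

end Risk

/-- A learning algorithm with internal randomness in `Ω`. On inputs `ε`, `δ` and internal
randomness `ω`, after having received the list `S` of samples from the example oracle, it either
calls the oracle once more (`step ε δ ω S = none`) or stops with a hypothesis `h`
(`step ε δ ω S = some h`). -/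
structure Learner (X Ω : Type*) where
  step : ℝ → ℝ → Ω → List X → Option (Set X)

/-- When the oracle answers the successive calls with `x 0, x 1, x 2, …`, the learner makes
exactly `k` calls and outputs the hypothesis `h`. -/
def Learner.Outputs {X Ω : Type*} (A : Learner X Ω) (ε δ : ℝ) (ω : Ω) (x : ℕ → X)
    (k : ℕ) (h : Set X) : Prop :=
  A.step ε δ ω (List.ofFn fun i : Fin k => x i) = some h ∧
    ∀ j < k, A.step ε δ ω (List.ofFn fun i : Fin j => x i) = none

/-- The joint law of the internal randomness and of the independent samples that the oracle
`EX(D_in)` supplies. -/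
def runLaw {X Ω : Type*} [MeasurableSpace X] [MeasurableSpace Ω] (P : Measure Ω) (D : Domain X) :
    Measure (Ω × (ℕ → X)) :=
  P.prod (Measure.infinitePi fun _ : ℕ => (D.inDist : Measure X))

/-- OOD detection is uniformly learnable for the domain space `𝒟` in the hypothesis space `H`
with OOD probability `α`: some sample bound `N` and some (possibly randomized) learning algorithm
are such that for all `ε, δ ∈ (0, 1/2)` and every domain of `𝒟`, the algorithm makes at most
`N ε δ` calls to the oracle and outputs a hypothesis of `H`, whose risk is, with probability at
least `1 - δ`, within `ε` of the smallest risk in `H`.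
No measurability is asked of the algorithm; an event that need not be measurable has probability
at least `1 - δ` when it contains a measurable event of probability at least `1 - δ`. -/
def UniformlyLearnable {X : Type u} [MeasurableSpace X] (𝒟 : Set (Domain X))
    (H : Set (Set X)) (α : ℝ) : Prop :=
  ∃ (N : ℝ → ℝ → ℕ) (Ω : Type v) (_ : MeasurableSpace Ω) (P : Measure Ω)
    (_ : IsProbabilityMeasure P) (A : Learner X Ω),
    ∀ ε ∈ Set.Ioo (0 : ℝ) (1 / 2), ∀ δ ∈ Set.Ioo (0 : ℝ) (1 / 2), ∀ D ∈ 𝒟,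
      (∀ᵐ p ∂(runLaw P D), ∃ k ≤ N ε δ, ∃ h ∈ H, A.Outputs ε δ p.1 p.2 k h) ∧
      ∃ E : Set (Ω × (ℕ → X)), MeasurableSet E ∧ 1 - δ ≤ (runLaw P D).real E ∧
        ∀ p ∈ E, ∃ k, ∃ h ∈ H, A.Outputs ε δ p.1 p.2 k h ∧
          risk α D h ≤ (⨅ h' : H, risk α D (h' : Set X)) + ε

/-- Disjoint Supports Assumption. -/
def DSA {X : Type*} [TopologicalSpace X] [MeasurableSpace X] (D : Domain X) : Prop :=
  Disjoint (D.inDist : Measure X).support (D.outDist : Measure X).support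

/-- Absolutely Continuous ID Distribution Assumption. -/
def ContID {n : ℕ} (D : Domain (EuclideanSpace ℝ (Fin n))) : Prop :=
  (D.inDist : Measure (EuclideanSpace ℝ (Fin n))) ≪ volume

/-- Convex ID Support Assumption. -/
def ConvexID {n : ℕ} (D : Domain (EuclideanSpace ℝ (Fin n))) : Prop :=
  Convex ℝ (D.inDist : Measure (EuclideanSpace ℝ (Fin n))).support

/-- The space of all domains over `ℝⁿ` that satisfy DSA, ContID and ConvexID. -/
def convexContDomains (n : ℕ) : Set (Domain (EuclideanSpace ℝ (Fin n))) :=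
  {D | DSA D ∧ ContID D ∧ ConvexID D}

end OODDetection

end

/-! ### Runs of a learner and coupled domains -/

namespace OODDetection

/-! The region above a parabola is convex and has arbitrarily many pairwise disjoint caps, each
removable by a half-space without destroying convexity. Take `M` pairs of caps; a bit string `b`
says which cap of each pair is kept as in-distribution, and the removed caps carry the
out-distribution. A constant share of the in-distribution, independent of `M`, is spread evenly over
the kept caps, so `N` samples leave most bits unknown when `M` is large compared with `N`.

All these domains are sampled from one common seed (`inSample`). The first `N` seeds expose at most
`2 * N` bits (`exists_capCoord`); flipping the others preserves the samples, hence the output. When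
at least half of the bits are flipped, the two risks of any hypothesis sum to at least a positive
constant (`le_risk_add_risk_capDomain`), whereas DSA makes the optimal risk zero. So the learner
fails for one domain of each flipped pair, and averaging over `b` (`exists_measure_le_half`) yields
a domain where it succeeds with probability at most 1/2. -/

theorem Learner.Outputs.congr {X Ω : Type*} {A : Learner X Ω} {ε δ : ℝ} {ω : Ω} {x y : ℕ → X}
    {k : ℕ} {h : Set X} (hx : A.Outputs ε δ ω x k h) (hxy : ∀ i < k, x i = y i) :
    A.Outputs ε δ ω y k h := by
  have key : ∀ j ≤ k, (List.ofFn fun i : Fin j => y i) = List.ofFn fun i : Fin j => x i := by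
    intro j hj
    congr 1
    funext i
    exact (hxy i (i.2.trans_le hj)).symm
  refine ⟨by rw [key k le_rfl]; exact hx.1, fun j hj => ?_⟩
  rw [key j hj.le]
  exact hx.2 j hj

theorem Learner.Outputs.unique {X Ω : Type*} {A : Learner X Ω} {ε δ : ℝ} {ω : Ω} {x : ℕ → X}
    {k k' : ℕ} {h h' : Set X} (hk : A.Outputs ε δ ω x k h) (hk' : A.Outputs ε δ ω x k' h') :
    k = k' ∧ h = h' := by
  have hkk : k = k' := by
    rcases lt_trichotomy k k' with hlt | heq | hlt
    · have := hk'.2 k hlt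
      rw [hk.1] at this
      simp at this
    · exact heq
    · have := hk.2 k' hlt
      rw [hk'.1] at this
      simp at this
  subst hkk
  have := hk.1.symm.trans hk'.1
  exact ⟨rfl, by simpa using this⟩

/-- Puts the runs for different domains on one probability space, so that they can be compared seed
by seed. -/
theorem runLaw_eq_map {X Y Ω : Type*} [MeasurableSpace X] [MeasurableSpace Y] [MeasurableSpace Ω]
    (P : Measure Ω) [IsProbabilityMeasure P] (ν : Measure Y) [IsProbabilityMeasure ν]
    (D : Domain X) (φ : Y → X) (hφ : Measurable φ)
    (hD : (D.inDist : Measure X) = ν.map φ) :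
    runLaw P D = (P.prod (Measure.infinitePi fun _ : ℕ => ν)).map
      (Prod.map id fun y k => φ (y k)) := by
  have hmeas : Measurable fun (y : ℕ → Y) k => φ (y k) := by fun_prop
  have : IsProbabilityMeasure (ν.map φ) := Measure.isProbabilityMeasure_map hφ.aemeasurable
  unfold runLaw
  rw [← Measure.map_prod_map _ _ measurable_id hmeas, Measure.map_id,
    Measure.infinitePi_map_pi (fun _ : ℕ => ν) (fun _ => hφ)]
  simp_rw [hD]

/-- If every point lies in at most half of the events of a finite family, in the sense that it lies
in at most one of the events indexed by `b` and `σ b` for some permutation `σ`, then the events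
cannot all have probability more than `1/2`. -/
theorem exists_measure_le_half {T B : Type*} [MeasurableSpace T] [Fintype B] [Nonempty B]
    (μ : Measure T) [IsProbabilityMeasure μ] (G : B → Set T) (hG : ∀ b, MeasurableSet (G b))
    (hσ : ∀ᵐ t ∂μ, ∃ σ : Equiv.Perm B, ∀ b, ¬ (t ∈ G b ∧ t ∈ G (σ b))) :
    ∃ b, μ.real (G b) ≤ 1 / 2 := by
  by_contra! hcon
  have hint : ∀ b, Integrable ((G b).indicator (fun _ => (1 : ℝ))) μ := fun b =>
    (integrable_const 1).indicator (hG b)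
  have hpt : ∀ᵐ t ∂μ, ∑ b, (G b).indicator (fun _ => (1 : ℝ)) t ≤ (Fintype.card B : ℝ) / 2 := by
    filter_upwards [hσ] with t ⟨σ, hσ⟩
    -- Reindexing by `σ` turns this sum into twice the number of events containing `t`.
    have h1 : ∑ b, ((G b).indicator (fun _ => (1 : ℝ)) t +
        (G (σ b)).indicator (fun _ => (1 : ℝ)) t) ≤ ∑ _b : B, (1 : ℝ) := by
      refine Finset.sum_le_sum fun b _ => ?_
      have := hσ b
      by_cases hb : t ∈ G b <;> by_cases hb' : t ∈ G (σ b) <;> simp_all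
    rw [Finset.sum_add_distrib,
      Equiv.sum_comp σ fun b => (G b).indicator (fun _ => (1 : ℝ)) t] at h1
    simp only [Finset.sum_const, Finset.card_univ, nsmul_eq_mul, mul_one] at h1
    linarith
  have hle := integral_mono_ae (integrable_finsetSum _ fun b _ => hint b)
    (integrable_const ((Fintype.card B : ℝ) / 2)) hpt
  rw [integral_finsetSum _ fun b _ => hint b] at hle
  simp only [integral_indicator_const _ (hG _), smul_eq_mul, mul_one, integral_const,
    probReal_univ, one_mul] at hle
  have hlt : ∑ _b : B, (1 / 2 : ℝ) < ∑ b, μ.real (G b) :=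
    Finset.sum_lt_sum_of_nonempty Finset.univ_nonempty fun b _ => hcon b
  simp only [Finset.sum_const, Finset.card_univ, nsmul_eq_mul] at hlt
  linarith

/-- Domains whose samples are coupled through a common seed cannot all be learned from `N`
samples, if for all seeds a permutation of the domains preserves the first `N` samples and moves
every domain to one that has no hypothesis of small risk in common with it. -/
theorem not_uniformlyLearnable_of_coupling {X : Type u} [MeasurableSpace X] {𝒟 : Set (Domain X)}
    {α ε : ℝ} (hε : ε ∈ Set.Ioo (0 : ℝ) (1 / 2))
    (hN : ∀ N : ℕ, ∃ (Y : Type u) (_ : MeasurableSpace Y) (ν : Measure Y)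
      (_ : IsProbabilityMeasure ν) (B : Type) (_ : Fintype B) (_ : Nonempty B)
      (D : B → Domain X) (φ : B → Y → X),
      (∀ b, D b ∈ 𝒟) ∧ (∀ b, ⨅ h' : (Set.univ : Set (Set X)), risk α (D b) (h' : Set X) ≤ 0) ∧
      (∀ b, Measurable (φ b)) ∧ (∀ b, ((D b).inDist : Measure X) = ν.map (φ b)) ∧
      ∀ y : ℕ → Y, ∃ σ : Equiv.Perm B, ∀ b, (∀ k < N, φ b (y k) = φ (σ b) (y k)) ∧
        ∀ h, ¬ (risk α (D b) h ≤ ε ∧ risk α (D (σ b)) h ≤ ε)) :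
    ¬ UniformlyLearnable.{u, v} 𝒟 Set.univ α := by
  rintro ⟨N, Ω, _, P, _, A, hA⟩
  obtain ⟨Y, _, ν, _, B, _, _, D, φ, hD, hinf, hφ, hmap, hσ⟩ := hN (N ε (1 / 4))
  -- Any `δ < 1/2` contradicts the bound `1/2` on the success probability.
  have hA' := fun b => hA ε hε (1 / 4) (by norm_num) (D b) (hD b)
  choose hae E hE hPE hEgood using hA'
  set μ := P.prod (Measure.infinitePi fun _ : ℕ => ν)
  let Φ : B → Ω × (ℕ → Y) → Ω × (ℕ → X) := fun b => Prod.map id fun y k => φ b (y k)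
  have hΦ : ∀ b, Measurable (Φ b) := fun b => by
    have := hφ b
    exact measurable_id.prodMap (by fun_prop)
  have hlaw : ∀ b, runLaw P (D b) = μ.map (Φ b) := fun b =>
    runLaw_eq_map P ν (D b) (φ b) (hφ b) (hmap b)
  have hae' : ∀ᵐ t ∂μ, ∀ b, ∃ k ≤ N ε (1 / 4), ∃ h ∈ Set.univ,
      A.Outputs ε (1 / 4) (Φ b t).1 (Φ b t).2 k h := by
    rw [ae_all_iff]
    intro b
    have := hae b
    rw [hlaw b] at this
    exact ae_of_ae_map (hΦ b).aemeasurable this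
  obtain ⟨b, hb⟩ := exists_measure_le_half μ (fun b => Φ b ⁻¹' E b) (fun b => hΦ b (hE b)) (by
    filter_upwards [hae'] with t ht
    obtain ⟨σ, hσt⟩ := hσ t.2
    refine ⟨σ, fun b ⟨hb, hb'⟩ => ?_⟩
    obtain ⟨k, h, -, hk, hr⟩ := hEgood b _ hb
    obtain ⟨k', h', -, hk', hr'⟩ := hEgood (σ b) _ hb'
    obtain ⟨k₀, hk₀, h₀, -, ho⟩ := ht b
    obtain ⟨rfl, rfl⟩ := ho.unique hk
    have hsame : A.Outputs ε (1 / 4) (Φ (σ b) t).1 (Φ (σ b) t).2 k₀ h₀ :=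
      hk.congr fun i hi => (hσt b).1 i (hi.trans_le hk₀)
    obtain ⟨rfl, rfl⟩ := hsame.unique hk'
    exact (hσt b).2 h₀ ⟨by linarith [hinf b], by linarith [hinf (σ b)]⟩)
  have hb' := hPE b
  rw [hlaw b, measureReal_def, Measure.map_apply (hΦ b) (hE b), ← measureReal_def] at hb'
  linarith


/-! ### Caps of a parabolic region -/

section Geometry

variable {n : ℕ} (p q : Fin n)

/-- For `c = capHeight p q t x > 0`, the point `x` lies beyond the line that cuts a small cap around
`x p = t` off the region `x p ^ 2 ≤ x q`. -/
noncomputable def capHeight (t : ℝ) (x : EuclideanSpace ℝ (Fin n)) : ℝ := 2 * t * x p - x q - t ^ 2 + 1 / 4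

theorem continuous_capHeight (t : ℝ) : Continuous (capHeight p q t) := by
  unfold capHeight
  fun_prop

variable {p q} in
theorem eq_of_capHeight_pos {s t : ℕ} {x : EuclideanSpace ℝ (Fin n)} (hx : x p ^ 2 ≤ x q)
    (hs : 0 < capHeight p q s x) (ht : 0 < capHeight p q t x) : s = t := by
  unfold capHeight at hs ht
  -- `capHeight` equals `1/4 - (x p - t)^2 - (x q - (x p)^2)`, so caps at distinct integers are
  -- disjoint.
  have h1 : |x p - s| < 1 / 2 := abs_lt_of_sq_lt_sq (by nlinarith) (by norm_num)
  have h2 : |x p - t| < 1 / 2 := abs_lt_of_sq_lt_sq (by nlinarith) (by norm_num)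
  rw [abs_lt] at h1 h2
  have h3 : (s : ℝ) < t + 1 := by linarith
  have h4 : (t : ℝ) < s + 1 := by linarith
  norm_cast at h3 h4
  omega

/-- The abscissa of the cap with index `i`. -/
def capPos {M : ℕ} (i : Fin M × Bool) : ℕ := 2 * i.1 + i.2.toNat

theorem capPos_injective {M : ℕ} : Function.Injective (capPos (M := M)) := by
  rintro ⟨⟨i, hi⟩, _ | _⟩ ⟨⟨j, hj⟩, _ | _⟩ h <;> simp [capPos] at h ⊢ <;> omega

/-- The region `x p ^ 2 ≤ x q` without the caps `(j, !b j)`. -/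
def truncatedRegion {M : ℕ} (b : Fin M → Bool) : Set (EuclideanSpace ℝ (Fin n)) :=
  {x | x p ^ 2 ≤ x q ∧ ∀ j, capHeight p q (capPos (j, !b j)) x ≤ 0}

/-- An open piece of the cap with index `i` that has positive distance to the rest of the region. -/
def capCore {M : ℕ} (i : Fin M × Bool) : Set (EuclideanSpace ℝ (Fin n)) :=
  {x | x p ^ 2 < x q ∧ 1 / 8 < capHeight p q (capPos i) x}

variable {M : ℕ}

theorem isClosed_truncatedRegion (b : Fin M → Bool) : IsClosed (truncatedRegion p q b) := by
  unfold truncatedRegion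
  refine (isClosed_le (by fun_prop) (by fun_prop)).and ?_
  simp only [Set.ofPred_forall]
  exact isClosed_iInter fun j => isClosed_le (continuous_capHeight p q _) continuous_const

theorem convex_truncatedRegion (b : Fin M → Bool) : Convex ℝ (truncatedRegion p q b) := by
  rintro x ⟨hx, hx'⟩ y ⟨hy, hy'⟩ a c ha hc hac
  refine ⟨?_, fun j => ?_⟩
  · simp only [PiLp.add_apply, PiLp.smul_apply, smul_eq_mul]
    obtain rfl : c = 1 - a := by linarith
    nlinarith [mul_nonneg (mul_nonneg ha hc) (sq_nonneg (x p - y p)),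
      mul_le_mul_of_nonneg_left hx ha, mul_le_mul_of_nonneg_left hy hc]
  · have h1 := mul_nonpos_of_nonneg_of_nonpos ha (hx' j)
    have h2 := mul_nonpos_of_nonneg_of_nonpos hc (hy' j)
    unfold capHeight at h1 h2 ⊢
    simp only [PiLp.add_apply, PiLp.smul_apply, smul_eq_mul]
    obtain rfl : c = 1 - a := by linarith
    nlinarith

theorem isOpen_capCore (i : Fin M × Bool) : IsOpen (capCore p q i) := by
  unfold capCore
  exact (isOpen_lt (by fun_prop) (by fun_prop)).and
    (isOpen_lt continuous_const (continuous_capHeight p q _))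

variable {p q} in
theorem capCore_nonempty (hpq : p ≠ q) (i : Fin M × Bool) : (capCore p q i).Nonempty := by
  obtain ⟨t, ht⟩ : ∃ t : ℝ, t = ((capPos i : ℕ) : ℝ) := ⟨_, rfl⟩
  -- This point is 1/16 above the parabola at abscissa `t` and has cap height 3/16.
  refine ⟨WithLp.toLp 2 (Function.update (fun _ => t) q (t ^ 2 + 1 / 16)), ?_, ?_⟩
  · simp [hpq]
  · simp only [capHeight, ← ht, ne_eq, hpq, not_false_eq_true, Function.update_of_ne,
      Function.update_self]
    linarith

theorem capCore_subset_truncatedRegion (b : Fin M → Bool) (j : Fin M) :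
    capCore p q (j, b j) ⊆ truncatedRegion p q b := by
  rintro x ⟨hx, hx'⟩
  refine ⟨hx.le, fun j' => ?_⟩
  by_contra! hcon
  have hpos : 0 < capHeight p q (capPos (j, b j)) x := by linarith
  have := capPos_injective (eq_of_capHeight_pos hx.le hcon hpos)
  rw [Prod.mk.injEq] at this
  obtain ⟨rfl, h⟩ := this
  simp at h

variable {p q} in
theorem closure_interior_truncatedRegion [NeZero M] (hpq : p ≠ q) (b : Fin M → Bool) :
    closure (interior (truncatedRegion p q b)) = truncatedRegion p q b := by
  rw [(convex_truncatedRegion p q b).closure_interior_eq_closure_of_nonempty_interior,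
    (isClosed_truncatedRegion p q b).closure_eq]
  exact (capCore_nonempty hpq (0, b 0)).mono
    (interior_maximal (capCore_subset_truncatedRegion p q b 0) (isOpen_capCore p q _))

/-- A point of the region lies in at most one cap, so that whether it belongs to a truncated region
depends on at most one bit. -/
theorem exists_capCoord [NeZero M] : ∃ s : EuclideanSpace ℝ (Fin n) → Fin M,
    ∀ (b b' : Fin M → Bool) (x), b (s x) = b' (s x) →
      (x ∈ truncatedRegion p q b ↔ x ∈ truncatedRegion p q b') := by
  classical
  have h : ∀ x : EuclideanSpace ℝ (Fin n), ∃ s : Fin M, x p ^ 2 ≤ x q → ∀ i : Fin M × Bool,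
      0 < capHeight p q (capPos i) x → i.1 = s := by
    intro x
    by_cases hx : x p ^ 2 ≤ x q ∧ ∃ i : Fin M × Bool, 0 < capHeight p q (capPos i) x
    · obtain ⟨hx, i, hi⟩ := hx
      exact ⟨i.1, fun _ i' hi' => by rw [capPos_injective (eq_of_capHeight_pos hx hi' hi)]⟩
    · exact ⟨0, fun hx' i hi => (hx ⟨hx', i, hi⟩).elim⟩
  choose s hs using h
  refine ⟨s, fun b b' x hb => ?_⟩
  have key : ∀ b b' : Fin M → Bool, b (s x) = b' (s x) →
      x ∈ truncatedRegion p q b → x ∈ truncatedRegion p q b' := by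
    rintro b b' hb ⟨hx, hx'⟩
    refine ⟨hx, fun j => ?_⟩
    by_contra! hcon
    obtain rfl := hs x hx _ hcon
    rw [← hb] at hcon
    exact (hx' _).not_gt hcon
  exact ⟨key b b' hb, key b' b hb.symm⟩

end Geometry

/-! ### Optimal risk under disjoint supports -/

section Risk

theorem risk_nonneg {X : Type*} [MeasurableSpace X] {α : ℝ} (hα : α ∈ Set.Ioo (0 : ℝ) 1)
    (D : Domain X) (h : Set X) : 0 ≤ risk α D h := by
  have := hα.1
  have : 0 ≤ 1 - α := by linarith [hα.2]
  unfold risk inRisk outRisk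
  positivity

theorem DSA.iInf_risk_le {X : Type*} [TopologicalSpace X] [HereditarilyLindelofSpace X]
    [MeasurableSpace X] {α : ℝ} (hα : α ∈ Set.Ioo (0 : ℝ) 1) {D : Domain X} (hD : DSA D) :
    ⨅ h' : (Set.univ : Set (Set X)), risk α D (h' : Set X) ≤ 0 := by
  -- The in-distribution support is itself a hypothesis of zero risk.
  refine (ciInf_le ⟨0, ?_⟩ ⟨(D.inDist : Measure X).support, Set.mem_univ _⟩).trans_eq ?_
  · rintro _ ⟨h, rfl⟩
    exact risk_nonneg hα D h
  · have h1 : (D.outDist : Measure X) (D.inDist : Measure X).support = 0 :=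
      measure_mono_null hD.subset_compl_right Measure.measure_compl_support
    simp [risk, inRisk, outRisk, measureReal_def, h1]

end Risk

/-! ### Product law of the seeds -/

section Seeds

variable {X : Type*} [MeasurableSpace X] {M : ℕ} {ι : Type*} [Fintype ι]

/-- The law of a uniformly distributed index, a point with law `γ`, and points with laws `κ i`, all
independent. -/
noncomputable def seedLaw (M : ℕ) (γ : Measure X) (κ : ι → Measure X) :
    Measure (Fin M × (X × (ι → X))) :=
  (((M : ENNReal)⁻¹) • Measure.count).prod (γ.prod (Measure.pi κ))

variable (γ : Measure X) [IsProbabilityMeasure γ] (κ : ι → Measure X)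
  [∀ i, IsProbabilityMeasure (κ i)]

instance isProbabilityMeasure_uniform [NeZero M] :
    IsProbabilityMeasure (((M : ENNReal)⁻¹) • (Measure.count : Measure (Fin M))) := by
  constructor
  simp [Measure.count_univ, ENNReal.inv_mul_cancel, NeZero.ne]

instance [NeZero M] : IsProbabilityMeasure (seedLaw M γ κ) := by
  unfold seedLaw
  infer_instance

theorem measurePreserving_seedLaw_point [NeZero M] :
    MeasurePreserving (fun y : Fin M × (X × (ι → X)) => y.2.1) (seedLaw M γ κ) γ :=
  measurePreserving_fst.comp measurePreserving_snd

theorem measurePreserving_seedLaw_eval [NeZero M] (i : ι) :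
    MeasurePreserving (fun y : Fin M × (X × (ι → X)) => y.2.2 i) (seedLaw M γ κ) (κ i) :=
  (measurePreserving_eval κ i).comp (measurePreserving_snd.comp measurePreserving_snd)

variable {γ κ} in
theorem sum_le_map_seedLaw [NeZero M] {g : Fin M × (X × (ι → X)) → X} (hg : Measurable g)
    {T : Set X} (e : Fin M → ι) (hgT : ∀ j, ∀ z ∈ T, ∀ w, g (j, z, w) = w (e j)) (A : Set X) :
    (M : ENNReal)⁻¹ * ∑ j, γ T * κ (e j) A ≤ (seedLaw M γ κ).map g A := by
  -- `A` comes from an arbitrary hypothesis, so it is replaced by a measurable hull.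
  rw [← measure_toMeasurable (μ := (seedLaw M γ κ).map g) A]
  set A' := toMeasurable ((seedLaw M γ κ).map g) A
  have hA' : MeasurableSet A' := measurableSet_toMeasurable _ _
  rw [Measure.map_apply hg hA', seedLaw, Measure.prod_apply (hg hA'), lintegral_smul_measure,
    lintegral_count, tsum_fintype, smul_eq_mul]
  gcongr with j
  calc γ T * κ (e j) A ≤ γ T * κ (e j) A' := by gcongr; exact subset_toMeasurable _ _
    _ = (γ.prod (Measure.pi κ)) (T ×ˢ ((fun w : ι → X => w (e j)) ⁻¹' A')) := by
        rw [Measure.prod_prod, (measurePreserving_eval κ (e j)).measure_preimage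
          hA'.nullMeasurableSet]
    _ ≤ _ := by
        refine measure_mono ?_
        rintro ⟨z, w⟩ ⟨hz, hw⟩
        simpa [hgT j z hz w] using hw

variable {γ κ} in
theorem sum_le_map_seedLaw_real [NeZero M] {g : Fin M × (X × (ι → X)) → X} (hg : Measurable g)
    {T : Set X} (e : Fin M → ι) (hgT : ∀ j, ∀ z ∈ T, ∀ w, g (j, z, w) = w (e j)) (A : Set X) :
    γ.real T / M * ∑ j, (κ (e j)).real A ≤ ((seedLaw M γ κ).map g).real A := by
  have := Measure.isProbabilityMeasure_map hg.aemeasurable (μ := seedLaw M γ κ)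
  have h := ENNReal.toReal_mono (measure_ne_top _ _) (sum_le_map_seedLaw (γ := γ) (κ := κ) hg e hgT A)
  rw [← measureReal_def] at h
  refine le_trans (le_of_eq ?_) h
  rw [ENNReal.toReal_mul, ENNReal.toReal_sum fun j _ => ENNReal.mul_ne_top (by simp) (by simp)]
  simp only [ENNReal.toReal_mul, ← measureReal_def, ← Finset.mul_sum, ENNReal.toReal_inv,
    ENNReal.toReal_natCast]
  ring

end Seeds


/-! ### The family of domains indexed by bit strings -/

section Construction

variable {n M : ℕ} (p q : Fin n)

/-- The distribution on `ℝⁿ` from which all samples outside the caps are taken. -/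
noncomputable def baseLaw (n : ℕ) : Measure (EuclideanSpace ℝ (Fin n)) :=
  (volume : Measure (EuclideanSpace ℝ (Fin n))).toFinite

instance : IsProbabilityMeasure (baseLaw n) := by
  unfold baseLaw
  infer_instance

theorem baseLaw_pos_of_isOpen {U : Set (EuclideanSpace ℝ (Fin n))} (hU : IsOpen U)
    (hne : U.Nonempty) : 0 < baseLaw n U := by
  rw [pos_iff_ne_zero, baseLaw, Ne, toFinite_apply_eq_zero_iff]
  exact (hU.measure_pos volume hne).ne'

/-- The distribution of the samples from the cap with index `i`. -/
noncomputable def capLaw (i : Fin M × Bool) : Measure (EuclideanSpace ℝ (Fin n)) :=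
  ProbabilityTheory.cond (baseLaw n) (capCore p q i)

variable {p q} in
theorem isProbabilityMeasure_capLaw (hpq : p ≠ q) (i : Fin M × Bool) :
    IsProbabilityMeasure (capLaw p q i) :=
  ProbabilityTheory.cond_isProbabilityMeasure
    (baseLaw_pos_of_isOpen (isOpen_capCore p q i) (capCore_nonempty hpq i)).ne'

theorem capLaw_ae_mem (i : Fin M × Bool) : ∀ᵐ x ∂(capLaw p q i), x ∈ capCore p q i :=
  ProbabilityTheory.ae_cond_mem (isOpen_capCore p q i).measurableSet

theorem baseLaw_absolutelyContinuous : baseLaw n ≪ volume :=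
  toFinite_absolutelyContinuous _

theorem capLaw_absolutelyContinuous (i : Fin M × Bool) : capLaw p q i ≪ volume :=
  ProbabilityTheory.cond_absolutelyContinuous.trans baseLaw_absolutelyContinuous

/-- The common seed of the samples of all domains. -/
abbrev Seed (n M : ℕ) : Type :=
  Fin M × (EuclideanSpace ℝ (Fin n) × (Fin M × Bool → EuclideanSpace ℝ (Fin n)))

open Classical in
/-- The in-distribution sample determined by a seed: the base point if it lies in the truncated
region, and a point of a random cap that is not cut off otherwise. -/
noncomputable def inSample (b : Fin M → Bool) (y : Seed n M) : EuclideanSpace ℝ (Fin n) :=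
  if y.2.1 ∈ truncatedRegion p q b then y.2.1 else y.2.2 (y.1, b y.1)

/-- The out-of-distribution sample determined by a seed: a point of a random cap that is cut
off. -/
def outSample (b : Fin M → Bool) (y : Seed n M) : EuclideanSpace ℝ (Fin n) :=
  y.2.2 (y.1, !b y.1)

theorem measurable_outSample (b : Fin M → Bool) : Measurable (outSample (n := n) b) := by
  refine measurable_from_prod_countable_right fun j => ?_
  exact (measurable_pi_apply (j, !b j)).comp measurable_snd

theorem measurable_inSample (b : Fin M → Bool) : Measurable (inSample p q b) := by
  unfold inSample
  refine Measurable.ite ?_ (by fun_prop) ?_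
  · exact (isClosed_truncatedRegion p q b).measurableSet.preimage
      (f := fun y : Seed n M => y.2.1) (by fun_prop)
  · refine measurable_from_prod_countable_right fun j => ?_
    exact (measurable_pi_apply (j, b j)).comp measurable_snd

/-- The law of the seeds. -/
noncomputable def capSeedLaw (M : ℕ) : Measure (Seed n M) := seedLaw M (baseLaw n) (capLaw p q)

variable [NeZero M]

variable {p q} in
theorem isProbabilityMeasure_capSeedLaw (hpq : p ≠ q) : IsProbabilityMeasure (capSeedLaw p q M) := by
  have := fun i : Fin M × Bool => isProbabilityMeasure_capLaw hpq i
  unfold capSeedLaw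
  infer_instance

variable {p q} in
theorem ae_capSeedLaw_eval (hpq : p ≠ q) {Q : Fin M × Bool → EuclideanSpace ℝ (Fin n) → Prop}
    (hQ : ∀ i, ∀ᵐ x ∂(capLaw p q i), Q i x) :
    ∀ᵐ y ∂(capSeedLaw p q M), ∀ i, Q i (y.2.2 i) := by
  have := fun i : Fin M × Bool => isProbabilityMeasure_capLaw hpq i
  rw [ae_all_iff]
  exact fun i => (measurePreserving_seedLaw_eval (baseLaw n) (capLaw p q) i).quasiMeasurePreserving.ae
    (hQ i)

variable {p q} in
theorem ae_capSeedLaw_point (hpq : p ≠ q) {Q : EuclideanSpace ℝ (Fin n) → Prop}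
    (hQ : ∀ᵐ x ∂(baseLaw n), Q x) : ∀ᵐ y ∂(capSeedLaw p q M), Q y.2.1 := by
  have := fun i : Fin M × Bool => isProbabilityMeasure_capLaw hpq i
  exact (measurePreserving_seedLaw_point (baseLaw n) (capLaw p q)).quasiMeasurePreserving.ae hQ

variable {p q} (hpq : p ≠ q)

/-- The domain whose in-distribution is spread over the region truncated according to `b` and whose
out-distribution is spread over the caps that are cut off. -/
noncomputable def capDomain (b : Fin M → Bool) : Domain (EuclideanSpace ℝ (Fin n)) :=
  have := isProbabilityMeasure_capSeedLaw (M := M) hpq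
  { inDist := ⟨(capSeedLaw p q M).map (inSample p q b),
      Measure.isProbabilityMeasure_map (measurable_inSample p q b).aemeasurable⟩
    outDist := ⟨(capSeedLaw p q M).map (outSample b),
      Measure.isProbabilityMeasure_map (measurable_outSample b).aemeasurable⟩ }

theorem capDomain_inDist (b : Fin M → Bool) :
    ((capDomain hpq b).inDist : Measure (EuclideanSpace ℝ (Fin n))) =
      (capSeedLaw p q M).map (inSample p q b) := rfl

theorem capDomain_outDist (b : Fin M → Bool) :
    ((capDomain hpq b).outDist : Measure (EuclideanSpace ℝ (Fin n))) =
      (capSeedLaw p q M).map (outSample b) := rfl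

theorem contID_capDomain (b : Fin M → Bool) : ContID (capDomain hpq b) := by
  refine Measure.AbsolutelyContinuous.mk fun A hA hA0 => ?_
  rw [capDomain_inDist, Measure.map_apply (measurable_inSample p q b) hA, measure_eq_zero_iff_ae_notMem]
  filter_upwards [ae_capSeedLaw_eval hpq (Q := fun _ x => x ∉ A) fun i =>
      measure_eq_zero_iff_ae_notMem.mp (capLaw_absolutelyContinuous p q i hA0),
    ae_capSeedLaw_point hpq (Q := fun x => x ∉ A)
      (measure_eq_zero_iff_ae_notMem.mp (baseLaw_absolutelyContinuous hA0))] with y hy hy'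
  rw [Set.mem_preimage, inSample]
  split_ifs
  · exact hy'
  · exact hy _

/-- All samples fall in the closed truncated region. Conversely, the base law charges every nonempty
open subset of its interior, which is dense in it by convexity. -/
theorem support_capDomain_inDist (b : Fin M → Bool) :
    ((capDomain hpq b).inDist : Measure (EuclideanSpace ℝ (Fin n))).support =
      truncatedRegion p q b := by
  have hprob := fun i : Fin M × Bool => isProbabilityMeasure_capLaw hpq i
  have hclosed := isClosed_truncatedRegion p q b
  apply Set.Subset.antisymm
  · refine Measure.support_subset_of_isClosed hclosed ?_
    rw [capDomain_inDist]
    rw [mem_ae_map_iff (measurable_inSample p q b).aemeasurable hclosed.measurableSet]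
    filter_upwards [ae_capSeedLaw_eval hpq (capLaw_ae_mem p q)] with y hy
    rw [Set.mem_preimage, inSample]
    split_ifs with h
    · exact h
    · exact capCore_subset_truncatedRegion p q b _ (hy _)
  · intro x hx
    rw [Measure.support_eq_forall_isOpen]
    intro U hxU hU
    rw [← closure_interior_truncatedRegion hpq b] at hx
    have hpos := baseLaw_pos_of_isOpen (hU.inter isOpen_interior)
      (mem_closure_iff.mp hx U hU hxU)
    have hpre := (measurePreserving_seedLaw_point (M := M) (baseLaw n)
      (capLaw (M := M) p q)).measure_preimage
        (hU.inter (isOpen_interior (s := truncatedRegion p q b))).measurableSet.nullMeasurableSet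
    rw [← hpre] at hpos
    refine hpos.trans_le ((measure_mono ?_).trans
      (Measure.le_map_apply (measurable_inSample p q b).aemeasurable U))
    rintro y ⟨hyU, hy⟩
    rw [Set.mem_preimage, inSample, if_pos (interior_subset hy)]
    exact hyU

theorem support_capDomain_outDist_subset (b : Fin M → Bool) :
    ((capDomain hpq b).outDist : Measure (EuclideanSpace ℝ (Fin n))).support ⊆
      ⋃ j, {x | 1 / 8 ≤ capHeight p q (capPos (j, !b j)) x} := by
  have hclosed : IsClosed (⋃ j, {x | 1 / 8 ≤ capHeight p q (capPos (j, !b j)) x}) :=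
    isClosed_iUnion_of_finite fun j => isClosed_le continuous_const (continuous_capHeight p q _)
  refine Measure.support_subset_of_isClosed hclosed ?_
  rw [capDomain_outDist]
  rw [mem_ae_map_iff (measurable_outSample b).aemeasurable hclosed.measurableSet]
  filter_upwards [ae_capSeedLaw_eval hpq (capLaw_ae_mem p q)] with y hy
  exact Set.mem_iUnion.mpr ⟨y.1, (hy _).2.le⟩

theorem dsa_capDomain (b : Fin M → Bool) : DSA (capDomain hpq b) := by
  rw [DSA, support_capDomain_inDist]
  refine Set.disjoint_left.mpr fun x hx hx' => ?_
  obtain ⟨j, hj⟩ := Set.mem_iUnion.mp (support_capDomain_outDist_subset hpq b hx')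
  have h1 := hx.2 j
  have h2 : 1 / 8 ≤ capHeight p q (capPos (j, !b j)) x := hj
  linarith

theorem capDomain_mem (b : Fin M → Bool) : capDomain hpq b ∈ convexContDomains n :=
  ⟨dsa_capDomain hpq b, contID_capDomain hpq b, by
    rw [ConvexID, support_capDomain_inDist]
    exact convex_truncatedRegion p q b⟩

/-- The part of the base distribution outside the region, which is redistributed to the caps. -/
def outerRegion (p q : Fin n) : Set (EuclideanSpace ℝ (Fin n)) := {x | x q < x p ^ 2}

theorem baseLaw_outerRegion_pos (hpq : p ≠ q) : 0 < (baseLaw n).real (outerRegion p q) := by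
  refine ENNReal.toReal_pos (baseLaw_pos_of_isOpen
    (isOpen_lt (by fun_prop) (by fun_prop)) ?_).ne' (measure_ne_top _ _)
  exact ⟨WithLp.toLp 2 (Function.update 0 p 1), by simp [hpq.symm]⟩

/-- A base point in `outerRegion` is rejected for every `b`, and the sample then comes from a
uniformly chosen kept cap. -/
theorem le_risk_capDomain {α : ℝ} (hα : α ∈ Set.Ioo (0 : ℝ) 1) (b : Fin M → Bool)
    (h : Set (EuclideanSpace ℝ (Fin n))) :
    min α (1 - α) * ((baseLaw n).real (outerRegion p q) / M *
      ∑ j, ((capLaw p q (j, b j)).real hᶜ + (capLaw p q (j, !b j)).real h)) ≤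
      risk α (capDomain hpq b) h := by
  have hprob := fun i : Fin M × Bool => isProbabilityMeasure_capLaw hpq i
  have h1 := sum_le_map_seedLaw_real (γ := baseLaw n) (κ := capLaw p q)
    (measurable_inSample p q b) (T := outerRegion p q) (fun j => (j, b j))
    (fun j z hz w => if_neg fun hz' => hz'.1.not_gt hz) hᶜ
  -- Restricting to `outerRegion` only weakens this bound, but gives both sums the same factor.
  have h2 := sum_le_map_seedLaw_real (γ := baseLaw n) (κ := capLaw p q)
    (measurable_outSample b) (T := outerRegion p q) (fun j => (j, !b j))
    (fun j z _ w => rfl) h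
  have h3 : min α (1 - α) ≤ α := min_le_left _ _
  have h4 : min α (1 - α) ≤ 1 - α := min_le_right _ _
  have h5 : 0 < min α (1 - α) := lt_min hα.1 (by linarith [hα.2])
  rw [Finset.sum_add_distrib, mul_add, mul_add]
  exact add_le_add (mul_le_mul h4 h1 (by positivity) (by linarith))
    (mul_le_mul h3 h2 (by positivity) hα.1.le)

/-- For `j ∈ S` each cap of pair `j` is in-distribution for one domain and out-distribution for the
other, so each costs any `h` at least 1 in total. -/
theorem le_risk_add_risk_capDomain {α : ℝ} (hα : α ∈ Set.Ioo (0 : ℝ) 1) (b b' : Fin M → Bool)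
    (S : Finset (Fin M)) (hS : M ≤ 2 * S.card) (hb : ∀ j ∈ S, b' j = !b j)
    (h : Set (EuclideanSpace ℝ (Fin n))) :
    min α (1 - α) * (baseLaw n).real (outerRegion p q) ≤
      risk α (capDomain hpq b) h + risk α (capDomain hpq b') h := by
  have hprob := fun i : Fin M × Bool => isProbabilityMeasure_capLaw hpq i
  refine le_trans ?_ (add_le_add (le_risk_capDomain hpq hα b h) (le_risk_capDomain hpq hα b' h))
  rw [← mul_add, ← mul_add, ← Finset.sum_add_distrib]
  have h5 : 0 < min α (1 - α) := lt_min hα.1 (by linarith [hα.2])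
  have hM : (0 : ℝ) < M := by exact_mod_cast Nat.pos_of_ne_zero (NeZero.ne M)
  refine mul_le_mul_of_nonneg_left ?_ h5.le
  have hone : ∀ i : Fin M × Bool, 1 ≤ (capLaw p q i).real h + (capLaw p q i).real hᶜ := by
    intro i
    have := measureReal_union_le (μ := capLaw p q i) h hᶜ
    rwa [Set.union_compl_self, probReal_univ] at this
  have hsum : (M : ℝ) ≤ ∑ j, ((capLaw p q (j, b j)).real hᶜ + (capLaw p q (j, !b j)).real h +
      ((capLaw p q (j, b' j)).real hᶜ + (capLaw p q (j, !b' j)).real h)) := by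
    calc (M : ℝ) ≤ ∑ _j ∈ S, (2 : ℝ) := by
          rw [Finset.sum_const, nsmul_eq_mul]
          exact_mod_cast hS.trans_eq (mul_comm _ _)
      _ ≤ ∑ j ∈ S, ((capLaw p q (j, b j)).real hᶜ + (capLaw p q (j, !b j)).real h +
          ((capLaw p q (j, b' j)).real hᶜ + (capLaw p q (j, !b' j)).real h)) := by
          refine Finset.sum_le_sum fun j hj => ?_
          rw [hb j hj, Bool.not_not]
          linarith [hone (j, b j), hone (j, !b j)]
      _ ≤ _ := Finset.sum_le_sum_of_subset_of_nonneg (Finset.subset_univ S)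
          fun j _ _ => by positivity
  calc (baseLaw n).real (outerRegion p q)
      = (baseLaw n).real (outerRegion p q) / M * M := by field_simp
    _ ≤ _ := mul_le_mul_of_nonneg_left hsum (by positivity)

end Construction

/-! ### Flipping the unseen bits -/

theorem exists_perm_flip {M : ℕ} (S : Finset (Fin M)) : ∃ σ : Equiv.Perm (Fin M → Bool),
    ∀ b j, σ b j = if j ∈ S then b j else !b j := by
  have hinv : Function.Involutive fun (b : Fin M → Bool) j => if j ∈ S then b j else !b j := by
    intro b
    funext j
    by_cases hj : j ∈ S <;> simp [hj]
  exact ⟨hinv.toPerm, fun b j => rfl⟩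

end OODDetection

theorem mainTheorem10 (n : ℕ) (hn : 2 ≤ n) (α : ℝ) (hα : α ∈ Set.Ioo (0 : ℝ) 1) :
    ¬ OODDetection.UniformlyLearnable.{0, v} (OODDetection.convexContDomains n)
      (Set.univ : Set (Set (EuclideanSpace ℝ (Fin n)))) α := by
  open OODDetection in
  obtain ⟨p, q, hpq⟩ : ∃ p q : Fin n, p ≠ q :=
    ⟨⟨0, by omega⟩, ⟨1, by omega⟩, by simp⟩
  have hc := baseLaw_outerRegion_pos hpq
  have hc1 : (baseLaw n).real (outerRegion p q) ≤ 1 := measureReal_le_one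
  have hm : 0 < min α (1 - α) := lt_min hα.1 (by linarith [hα.2])
  have hm1 : min α (1 - α) ≤ 1 := (min_le_left _ _).trans hα.2.le
  have hmc := mul_pos hm hc
  have hmc1 := mul_le_one₀ hm1 hc.le hc1
  refine not_uniformlyLearnable_of_coupling
    -- The two risks sum to at least `4 * ε`, so they cannot both be at most `ε`.
    (ε := min α (1 - α) * (baseLaw n).real (outerRegion p q) / 4)
    ⟨by linarith, by linarith⟩ fun N => ?_
  -- At most `2 * N` bits are exposed, so more than half stay hidden; the `+ 1` covers `N = 0`.
  have : NeZero (4 * N + 1) := ⟨by omega⟩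
  refine ⟨Seed n (4 * N + 1), inferInstance, capSeedLaw p q _,
    isProbabilityMeasure_capSeedLaw hpq, Fin (4 * N + 1) → Bool, inferInstance, inferInstance,
    capDomain hpq, inSample p q, capDomain_mem hpq, fun b => (dsa_capDomain hpq b).iInf_risk_le hα,
    measurable_inSample p q, capDomain_inDist hpq, fun y => ?_⟩
  obtain ⟨s, hs⟩ := exists_capCoord p q (M := 4 * N + 1)
  -- The bits that the first `N` samples can depend on. `S` is computed from the seeds, not from
  -- `b`, so flipping outside it is a permutation.
  set S : Finset (Fin (4 * N + 1)) := (Finset.range N).image (fun k => (y k).1) ∪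
    (Finset.range N).image (fun k => s (y k).2.1)
  have hS : S.card ≤ N + N := (Finset.card_union_le _ _).trans
    (add_le_add (Finset.card_image_le.trans_eq (Finset.card_range N))
      (Finset.card_image_le.trans_eq (Finset.card_range N)))
  obtain ⟨σ, hσ⟩ := exists_perm_flip S
  refine ⟨σ, fun b => ⟨fun k hk => ?_, fun h ⟨h1, h2⟩ => ?_⟩⟩
  · have hk' := Finset.mem_range.mpr hk
    have hmem1 : (y k).1 ∈ S := Finset.mem_union_left _ (Finset.mem_image_of_mem _ hk')
    have hmem2 : s (y k).2.1 ∈ S :=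
      Finset.mem_union_right _ (Finset.mem_image_of_mem (fun k => s (y k).2.1) hk')
    have hiff := hs b (σ b) (y k).2.1 (by rw [hσ, if_pos hmem2])
    by_cases hmem : (y k).2.1 ∈ truncatedRegion p q b
    · rw [inSample, inSample, if_pos hmem, if_pos (hiff.mp hmem)]
    · rw [inSample, inSample, if_neg hmem, if_neg (mt hiff.mpr hmem), hσ, if_pos hmem1]
  · have hle := le_risk_add_risk_capDomain hpq hα b (σ b) Sᶜ
      (by rw [Finset.card_compl, Fintype.card_fin]; omega)
      (fun j hj => by rw [hσ, if_neg (Finset.mem_compl.mp hj)]) h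
    linarith
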